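/- Let $\mathcal M$ be a complete connected (finite-dimensional, smooth) Riemannian manifold, and let $d:\mathcal M\times\mathcal M\to[0,\infty)$ be symmetric and satisfy the triangle inequality ($d$ may differ from the Riemannian distance). Geodesics are the affinely parametrized curves $\gamma:[0,1]\to\mathcal M$ with parallel velocity for the Levi-Civita connection, and $\operatorname{Exp}_x(v)=\gamma(1)$ for the geodesic with $\gamma(0)=x$, $\gamma'(0)=v$. Let $\mathcal C\subset\mathcal M$ be compact and uniquely geodesically convex: any two points $x,y\in\mathcal C$ are joined by a distance-minimizing geodesic contained in $\mathcal C$, and this is the only geodesic from $x$ to $y$ contained in $\mathcal C$. For $x,y\in\mathcal C$ let $\operatorname{Exp}_x^{-1}(y)\in T_x\mathcal M$ be the initial velocity of that geodesic. Let $\alpha>0$ and suppose that $\mathcal C$ is double geodesically $\alpha$-strongly convex with respect to $d$: for all $x,y\in\mathcal C$, the geodesic $\gamma$ in $\mathcal C$ from $x$ to $y$, all $t\in[0,1]$ and all $z\in T_{\gamma(t)}\mathcal M$ with $\|z\|_{\gamma(t)}\le\alpha\,t(1-t)\,d(x,y)^2$, the point $\operatorname{Exp}_{\gamma(t)}(z)$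 exists and lies in $\mathcal C$. For $x\in\mathcal M$ and $u,v\in T_x\mathcal M$ let $\operatorname{Exp}_x(u,v)=\operatorname{Exp}_{\operatorname{Exp}_x(u)}(\Gamma v)$ be the double exponential map, where $\Gamma$ is Levi-Civita parallel transport along $s\mapsto\operatorname{Exp}_x(su)$, $s\in[0,1]$. Suppose that $h_x(u,v)=u+v$ is an exponential map operator at every $x\in\mathcal C$, that is, $$\operatorname{Exp}_x(u+v)=\operatorname{Exp}_x(u,v)\qquad\text{for all }x\in\mathcal C,\ u,v\in T_x\mathcal M .$$ Then for all $x\in\mathcal C$, all $w\in T_x\mathcal M$ and all $v\in\operatorname{argmax}_{z\in\mathcal C}\langle w,\operatorname{Exp}_x^{-1}(z)\rangle_x$, $$\langle w,\operatorname{Exp}_x^{-1}(v)\rangle_x\ \ge\ \frac{\alpha}{2}\,\|w\|_x\,d(x,v)^2 .$$ Moreover, if $\ell>0$ satisfies $\ell\,\|\operatorname{Exp}_x^{-1}(y)\|_x\le d(x,y)$ for all $x,y\in\mathcal C$ (for the Riemannian distance, $\ell=1$ works), then $\mathcal C$ satisfies the Riemannian scaling inequality with constant $\ell^2\alpha/2$: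 for all such $x,w,v$, $$\langle w,\operatorname{Exp}_x^{-1}(v)\rangle_x\ \ge\ \frac{\ell^2\alpha}{2}\,\|w\|_x\,\|\operatorname{Exp}_x^{-1}(v)\|_x^2 .$$ -/

import Mathlib

open Set Manifold Bundle
open scoped ContDiff

noncomputable section

namespace RiemGeo

section Definitions

variable {E : Type*} [NormedAddCommGroup E] [NormedSpace ℝ E]
  {M : Type*} [MetricSpace M] [ChartedSpace E M]

/-- The velocity `γ'(t)` of a curve `γ : [0, 1] → M` (one-sided at the end points). -/
def velocity (γ : ℝ → M) (t : ℝ) : TangentSpace 𝓘(ℝ, E) (γ t) :=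
  mfderivWithin 𝓘(ℝ, ℝ) 𝓘(ℝ, E) γ (Icc 0 1) t (1 : ℝ)

/-- The components, in the chart around `p`, of a tangent vector `v` at `b`. -/
def chartVec (p b : M) (v : TangentSpace 𝓘(ℝ, E) b) : E :=
  mfderiv 𝓘(ℝ, E) 𝓘(ℝ, E) (extChartAt 𝓘(ℝ, E) p) b v

variable [RiemannianBundle (fun x : M => TangentSpace 𝓘(ℝ, E) x)]

/-- The metric tensor in the chart around `p`, at the point with coordinates `y`:
`chartMetric p y a b` is `∑ g_ij(y) a^i b^j`. -/
def chartMetric (p : M) (y a b : E) : ℝ :=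
  inner ℝ
    (mfderiv 𝓘(ℝ, E) 𝓘(ℝ, E) (extChartAt 𝓘(ℝ, E) p).symm y a)
    (mfderiv 𝓘(ℝ, E) 𝓘(ℝ, E) (extChartAt 𝓘(ℝ, E) p).symm y b)

/-- The Christoffel symbol of the first kind of the Levi-Civita connection in the chart around `p`,
`⟨∇_a b, c⟩ = (∂_a g(b, c) + ∂_b g(a, c) - ∂_c g(a, b)) / 2` for constant coefficient vector
fields `a`, `b`, `c` of the chart. -/
def christoffel (p : M) (y a b c : E) : ℝ :=
  (fderiv ℝ (fun q => chartMetric p q b c) y a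
    + fderiv ℝ (fun q => chartMetric p q a c) y b
    - fderiv ℝ (fun q => chartMetric p q a b) y c) / 2

/-- The vector field `V` along the curve `γ : [0, 1] → M` is parallel for the Levi-Civita
connection: in every chart, `⟨V' + Γ(γ', V), c⟩ = 0` for all `c`. -/
def IsParallelAlong (γ : ℝ → M) (V : ∀ t, TangentSpace 𝓘(ℝ, E) (γ t)) : Prop :=
  ∀ p : M, ∀ t ∈ Icc (0 : ℝ) 1, γ t ∈ (chartAt E p).source →
    ∃ V' : E, HasDerivWithinAt (fun s => chartVec p (γ s) (V s)) V' (Icc 0 1) t ∧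
      ∀ c : E, chartMetric p (extChartAt 𝓘(ℝ, E) p (γ t)) V' c
        + christoffel p (extChartAt 𝓘(ℝ, E) p (γ t))
            (chartVec p (γ t) (velocity γ t)) (chartVec p (γ t) (V t)) c = 0

variable (E) in
/-- `γ : [0, 1] → M` is a (not necessarily minimizing) geodesic: its velocity is parallel along it.
Only the values of `γ` on `[0, 1]` matter. -/
def IsGeodesic (γ : ℝ → M) : Prop :=
  MDifferentiableOn 𝓘(ℝ, ℝ) 𝓘(ℝ, E) γ (Icc 0 1) ∧ IsParallelAlong (E := E) γ (velocity γ)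

variable (E) in
/-- The curve `γ : [0, 1] → M` is distance minimizing. -/
def IsMinimizing (γ : ℝ → M) : Prop :=
  pathELength 𝓘(ℝ, E) γ 0 1 = edist (γ 0) (γ 1)

/-- `Exp_x(v)` exists and is equal to `y`. -/
def HasExp (x : M) (v : TangentSpace 𝓘(ℝ, E) x) (y : M) : Prop :=
  ∃ γ : ℝ → M, IsGeodesic E γ ∧
    (⟨γ 0, velocity γ 0⟩ : TangentBundle 𝓘(ℝ, E) M) = ⟨x, v⟩ ∧ γ 1 = y

/-- The double exponential `Exp_x(u, v) = Exp_{Exp_x(u)}(Γ v)` exists and is equal to `y`, where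
`Γ v` is the parallel transport of `v` along the geodesic `t ↦ Exp_x(t u)`, `t ∈ [0, 1]`. -/
def HasDoubleExp (x : M) (u v : TangentSpace 𝓘(ℝ, E) x) (y : M) : Prop :=
  ∃ (γ : ℝ → M) (V : ∀ t, TangentSpace 𝓘(ℝ, E) (γ t)),
    IsGeodesic E γ ∧ (⟨γ 0, velocity γ 0⟩ : TangentBundle 𝓘(ℝ, E) M) = ⟨x, u⟩ ∧
    IsParallelAlong γ V ∧ (⟨γ 0, V 0⟩ : TangentBundle 𝓘(ℝ, E) M) = ⟨x, v⟩ ∧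
    HasExp (γ 1) (V 1) y

/-- `h` is an exponential map operator at `x`: `Exp_x(h(u, v)) = Exp_x(u, v)` for all `u`, `v`.
The equality is that of possibly undefined points; on a complete manifold both sides always
exist. -/
def IsExpMapOperator (x : M)
    (h : TangentSpace 𝓘(ℝ, E) x → TangentSpace 𝓘(ℝ, E) x → TangentSpace 𝓘(ℝ, E) x) : Prop :=
  ∀ (u v : TangentSpace 𝓘(ℝ, E) x) (y : M), HasExp x (h u v) y ↔ HasDoubleExp x u v y

variable (E) in
/-- `γ` is a geodesic from `x` to `y` contained in `C`. -/
def IsGeodesicIn (C : Set M) (x y : M) (γ : ℝ → M) : Prop :=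
  IsGeodesic E γ ∧ γ 0 = x ∧ γ 1 = y ∧ MapsTo γ (Icc 0 1) C

variable (E) in
/-- `C` is uniquely geodesically convex: any two of its points are joined by a minimizing geodesic
contained in `C`, and by only one geodesic contained in `C`. -/
structure IsUniquelyGeodesicallyConvex (C : Set M) : Prop where
  isClosed : IsClosed C
  exists_minimizing : ∀ x ∈ C, ∀ y ∈ C, ∃ γ, IsGeodesicIn E C x y γ ∧ IsMinimizing E γ
  unique : ∀ x ∈ C, ∀ y ∈ C, ∀ γ₁ γ₂, IsGeodesicIn E C x y γ₁ → IsGeodesicIn E C x y γ₂ →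
    EqOn γ₁ γ₂ (Icc 0 1)

/-- `v` is the initial velocity of a minimizing geodesic from `x` to `y` contained in `C`. -/
def IsLog (C : Set M) (x y : M) (v : TangentSpace 𝓘(ℝ, E) x) : Prop :=
  ∃ γ : ℝ → M, IsGeodesicIn E C x y γ ∧ IsMinimizing E γ ∧
    (⟨γ 0, velocity γ 0⟩ : TangentBundle 𝓘(ℝ, E) M) = ⟨x, v⟩

open Classical in
/-- The inverse exponential map (logarithm) `Exp_x⁻¹(y)` of a uniquely geodesically convex set `C`,
for `x`, `y` in `C`. (The default value `0` is never used for such `C`, `x`, `y`.) -/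
def logMap (C : Set M) (x y : M) : TangentSpace 𝓘(ℝ, E) x :=
  if h : ∃ v : TangentSpace 𝓘(ℝ, E) x, IsLog C x y v then h.choose else 0

/-- A distance function on `M`, possibly different from the Riemannian distance. -/
structure IsDistanceFunction (d : M → M → ℝ) : Prop where
  nonneg : ∀ x y, 0 ≤ d x y
  symm : ∀ x y, d x y = d y x
  triangle : ∀ x y z, d x z ≤ d x y + d y z

variable (E) in
/-- `C` is double geodesically `α`-strongly convex with respect to `d`. -/
def IsDoubleGeodesicallyStronglyConvex (α : ℝ) (d : M → M → ℝ) (C : Set M) : Prop :=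
  ∀ x ∈ C, ∀ y ∈ C, ∀ γ, IsGeodesicIn E C x y γ →
    ∀ t ∈ Icc (0 : ℝ) 1, ∀ z : TangentSpace 𝓘(ℝ, E) (γ t),
      ‖z‖ ≤ α * t * (1 - t) * d x y ^ 2 → ∃ q ∈ C, HasExp (γ t) z q

variable (E) in
/-- The scaling inequality for `C` with constant `β`, in which `ρ x v` measures how far `v` is
from `x`: `⟨w, Exp_x⁻¹(v)⟩ ≥ β ‖w‖ ρ(x, v)²` for all `x ∈ C`, `w ∈ T_x M` and all maximizers
`v ∈ C` of `z ↦ ⟨w, Exp_x⁻¹(z)⟩` on `C`. -/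
def ScalingInequality (C : Set M) (β : ℝ) (ρ : M → M → ℝ) : Prop :=
  ∀ x ∈ C, ∀ w : TangentSpace 𝓘(ℝ, E) x, ∀ v ∈ C,
    IsMaxOn (fun z => inner ℝ w (logMap C x z)) C v →
      inner ℝ w (logMap C x v) ≥ β * ‖w‖ * ρ x v ^ 2

variable (E) in
/-- The Riemannian scaling inequality with constant `β`:
`⟨w, Exp_x⁻¹(v)⟩ ≥ β ‖w‖ ‖Exp_x⁻¹(v)‖²`. -/
def RiemannianScalingInequality (C : Set M) (β : ℝ) : Prop :=
  ScalingInequality E C β (fun x v => ‖(logMap C x v : TangentSpace 𝓘(ℝ, E) x)‖)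

end Definitions

end RiemGeo

end

noncomputable section

namespace RiemGeo

set_option maxSynthPendingDepth 3

/-! ### Coordinates on the tangent bundle and smoothness of the metric tensor -/

section Charts

variable {E : Type*} [NormedAddCommGroup E] [NormedSpace ℝ E]
  {M : Type*} [MetricSpace M] [ChartedSpace E M] [IsManifold 𝓘(ℝ, E) ∞ M]

/-! Write `u = Exp_x⁻¹(v)`. The core is that a whole ball around `u / 2` consists of logarithms of
points of `C`: if `‖z‖ ≤ (α / 4) d(x, v)²`, then `σ(s) = Exp_x(s (u / 2 + z))` equals the double
exponential `Exp_x((s / 2) u, s z)`. This starts from the point of parameter `s / 2` on the geodesic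
to `v` and moves by a vector of norm `s ‖z‖`, which strong convexity allows. So `σ` stays in `C`,
and unique convexity makes its initial velocity `u / 2 + z` the logarithm of `σ(1)`
(`exists_logMap_eq_half_add`). Taking `z` of maximal length in the direction of `w`, maximality of
`v` gives `⟨w, u⟩ / 2 + (α / 4) ‖w‖ d(x, v)² ≤ ⟨w, u⟩`, which is the claim.

Two facts of Riemannian geometry support this. Parallel transport is isometric
(`IsParallelAlong.norm_eq`), so the transported `s z` keeps its norm. A geodesic is determined by
its initial velocity (`IsGeodesic.eqOn`), so that points given by `HasExp` can be identified; this
is uniqueness for the geodesic equation in charts. -/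

theorem contMDiffOn_mfderiv_extChartAt_symm (p : M) (a : E) :
    ContMDiffOn 𝓘(ℝ, E) (𝓘(ℝ, E).prod 𝓘(ℝ, E)) ∞
      (fun y => (⟨(extChartAt 𝓘(ℝ, E) p).symm y,
        mfderiv 𝓘(ℝ, E) 𝓘(ℝ, E) (extChartAt 𝓘(ℝ, E) p).symm y a⟩ : TangentBundle 𝓘(ℝ, E) M))
      (extChartAt 𝓘(ℝ, E) p).target := by
  have hopen : IsOpen (extChartAt 𝓘(ℝ, E) p).target := isOpen_extChartAt_target p
  have h := (contMDiffOn_extChartAt_symm (I := 𝓘(ℝ, E)) (n := ∞) p).contMDiffOn_tangentMapWithin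
    (m := ∞) le_rfl hopen.uniqueMDiffOn
  have hs : ContMDiffOn 𝓘(ℝ, E) (𝓘(ℝ, E).prod 𝓘(ℝ, E)) ∞
      (fun y : E => (⟨y, (a : TangentSpace 𝓘(ℝ, E) y)⟩ : TangentBundle 𝓘(ℝ, E) E)) (extChartAt 𝓘(ℝ, E) p).target := by
    exact contMDiffOn_vectorSpace_iff_contDiffOn.2 contDiffOn_const
  refine (h.comp hs (fun y hy => hy)).congr fun y hy => ?_
  simp only [Function.comp_def, tangentMapWithin]
  rw [mfderivWithin_of_isOpen hopen hy]

theorem mfderiv_comp_mfderiv_symm (p : M) {y : E} (hy : y ∈ (extChartAt 𝓘(ℝ, E) p).target) (a : E) :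
    chartVec p ((extChartAt 𝓘(ℝ, E) p).symm y)
      (mfderiv 𝓘(ℝ, E) 𝓘(ℝ, E) (extChartAt 𝓘(ℝ, E) p).symm y a) = a := by
  have h := mfderiv_extChartAt_comp_mfderivWithin_extChartAt_symm (I := 𝓘(ℝ, E)) hy
  rw [modelWithCornersSelf_coe, range_id, mfderivWithin_univ] at h
  exact DFunLike.congr_fun h a

theorem mfderiv_symm_chartVec (p : M) {b : M} (hb : b ∈ (chartAt E p).source)
    (v : TangentSpace 𝓘(ℝ, E) b) :
    (⟨(extChartAt 𝓘(ℝ, E) p).symm (extChartAt 𝓘(ℝ, E) p b),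
      mfderiv 𝓘(ℝ, E) 𝓘(ℝ, E) (extChartAt 𝓘(ℝ, E) p).symm (extChartAt 𝓘(ℝ, E) p b)
        (chartVec p b v : E)⟩ : TangentBundle 𝓘(ℝ, E) M) = ⟨b, v⟩ := by
  have hb' : b ∈ (extChartAt 𝓘(ℝ, E) p).source := by simpa using hb
  have h := mfderivWithin_extChartAt_symm_comp_mfderiv_extChartAt' (I := 𝓘(ℝ, E)) hb'
  rw [modelWithCornersSelf_coe, range_id, mfderivWithin_univ] at h
  have h1 := DFunLike.congr_fun h v
  have h2 : (extChartAt 𝓘(ℝ, E) p).symm (extChartAt 𝓘(ℝ, E) p b) = b :=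
    (extChartAt 𝓘(ℝ, E) p).left_inv hb'
  exact Bundle.TotalSpace.ext h2 (heq_of_eq h1)

/-- Carries equalities obtained from the differential equation in coordinates back to the tangent
bundle. -/
theorem totalSpace_eq_of_chart_eq (p : M) {b b' : M} (hb : b ∈ (chartAt E p).source)
    (hb' : b' ∈ (chartAt E p).source) {v : TangentSpace 𝓘(ℝ, E) b} {v' : TangentSpace 𝓘(ℝ, E) b'}
    (h : extChartAt 𝓘(ℝ, E) p b = extChartAt 𝓘(ℝ, E) p b')
    (hv : chartVec p b v = chartVec p b' v') :
    (⟨b, v⟩ : TangentBundle 𝓘(ℝ, E) M) = ⟨b', v'⟩ := by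
  rw [← mfderiv_symm_chartVec p hb, ← mfderiv_symm_chartVec p hb', h, hv]

theorem hasDerivWithinAt_extChartAt_comp {γ : ℝ → M}
    (hγ : MDifferentiableOn 𝓘(ℝ, ℝ) 𝓘(ℝ, E) γ (Icc 0 1)) (p : M) {t : ℝ}
    (ht : t ∈ Icc (0 : ℝ) 1) (hp : γ t ∈ (chartAt E p).source) :
    HasDerivWithinAt (fun s => extChartAt 𝓘(ℝ, E) p (γ s)) (chartVec p (γ t) (velocity γ t))
      (Icc 0 1) t := by
  have h1 := (hγ t ht).hasMFDerivWithinAt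
  have h2 := (mdifferentiableAt_extChartAt (I := 𝓘(ℝ, E)) hp).hasMFDerivAt
  obtain ⟨D, hD, h3⟩ : ∃ D : ℝ →L[ℝ] E, D 1 = chartVec p (γ t) (velocity γ t) ∧
      HasMFDerivWithinAt 𝓘(ℝ, ℝ) 𝓘(ℝ, E) (fun s => extChartAt 𝓘(ℝ, E) p (γ s)) (Icc 0 1) t D :=
    ⟨_, rfl, h2.comp_hasMFDerivWithinAt t h1⟩
  have h4 : HasFDerivWithinAt (fun s => extChartAt 𝓘(ℝ, E) p (γ s)) D (Icc 0 1) t :=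
    hasMFDerivWithinAt_iff_hasFDerivWithinAt.1 h3
  have h5 := h4.hasDerivWithinAt
  rw [hD] at h5
  exact h5

variable [RiemannianBundle (fun x : M => TangentSpace 𝓘(ℝ, E) x)]
  [IsContMDiffRiemannianBundle 𝓘(ℝ, E) ∞ E (fun x : M => TangentSpace 𝓘(ℝ, E) x)]

theorem contDiffOn_chartMetric (p : M) (a b : E) :
    ContDiffOn ℝ ∞ (fun y => chartMetric p y a b) (extChartAt 𝓘(ℝ, E) p).target := by
  rw [← contMDiffOn_iff_contDiffOn]
  exact ContMDiffOn.inner_bundle (E := fun x : M => TangentSpace 𝓘(ℝ, E) x)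
    (contMDiffOn_mfderiv_extChartAt_symm p a) (contMDiffOn_mfderiv_extChartAt_symm p b)

end Charts

/-! ### The metric tensor, Christoffel symbols and geodesic equation in a chart -/

section Metric

variable {E : Type*} [NormedAddCommGroup E] [NormedSpace ℝ E]
  {M : Type*} [MetricSpace M] [ChartedSpace E M]
  [RiemannianBundle (fun x : M => TangentSpace 𝓘(ℝ, E) x)]

theorem chartMetric_comm (p : M) (y a b : E) : chartMetric p y a b = chartMetric p y b a :=
  real_inner_comm _ _

theorem chartMetric_add_left (p : M) (y a a' b : E) :
    chartMetric p y (a + a') b = chartMetric p y a b + chartMetric p y a' b :=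
  (congrArg (fun u => inner ℝ u _) (map_add (mfderiv 𝓘(ℝ, E) 𝓘(ℝ, E)
    (extChartAt 𝓘(ℝ, E) p).symm y) a a')).trans (inner_add_left _ _ _)

theorem chartMetric_smul_left (p : M) (y : E) (c : ℝ) (a b : E) :
    chartMetric p y (c • a) b = c • chartMetric p y a b :=
  (congrArg (fun u => inner ℝ u _) (map_smul (mfderiv 𝓘(ℝ, E) 𝓘(ℝ, E)
    (extChartAt 𝓘(ℝ, E) p).symm y) c a)).trans (real_inner_smul_left _ _ _)

variable [FiniteDimensional ℝ E]

/-- The metric tensor in the chart around `p`, as a continuous bilinear form. -/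
def metricForm (p : M) (y : E) : E →L[ℝ] E →L[ℝ] ℝ :=
  LinearMap.toContinuousLinearMap
    ((LinearMap.toContinuousLinearMap (𝕜 := ℝ) (E := E) (F' := ℝ)).toLinearMap ∘ₗ
      LinearMap.mk₂ ℝ (chartMetric p y)
        (chartMetric_add_left p y) (chartMetric_smul_left p y)
        (fun a b b' => by simp only [chartMetric_comm p y a, chartMetric_add_left])
        (fun c a b => by simp only [chartMetric_comm p y a, chartMetric_smul_left]))

theorem metricForm_apply (p : M) (y a b : E) : metricForm p y a b = chartMetric p y a b := rfl

variable [IsManifold 𝓘(ℝ, E) ∞ M]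

omit [FiniteDimensional ℝ E] in
theorem chartMetric_chartVec (p : M) {b : M} (hb : b ∈ (chartAt E p).source)
    (v w : TangentSpace 𝓘(ℝ, E) b) :
    chartMetric p (extChartAt 𝓘(ℝ, E) p b) (chartVec p b v) (chartVec p b w) = inner ℝ v w := by
  have hb' : b ∈ (extChartAt 𝓘(ℝ, E) p).source := by simpa using hb
  obtain ⟨y, hy, rfl⟩ : ∃ y ∈ (extChartAt 𝓘(ℝ, E) p).target, (extChartAt 𝓘(ℝ, E) p).symm y = b :=
    ⟨_, (extChartAt 𝓘(ℝ, E) p).map_source hb', (extChartAt 𝓘(ℝ, E) p).left_inv hb'⟩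
  rw [(extChartAt 𝓘(ℝ, E) p).right_inv hy]
  have h := mfderivWithin_extChartAt_symm_comp_mfderiv_extChartAt (I := 𝓘(ℝ, E)) hy
  rw [modelWithCornersSelf_coe, range_id, mfderivWithin_univ] at h
  have hv (v) : mfderiv 𝓘(ℝ, E) 𝓘(ℝ, E) (extChartAt 𝓘(ℝ, E) p).symm y
    (chartVec p ((extChartAt 𝓘(ℝ, E) p).symm y) v : E) = v := DFunLike.congr_fun h v
  rw [chartMetric, hv, hv]

/-- Positive definiteness gives injectivity, and `E` and its dual have equal finite dimension. -/
theorem isInvertible_metricForm (p : M) {y : E} (hy : y ∈ (extChartAt 𝓘(ℝ, E) p).target) :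
    (metricForm p y).IsInvertible := by
  have hinj : Function.Injective (metricForm p y).toLinearMap := by
    rw [← LinearMap.ker_eq_bot, LinearMap.ker_eq_bot']
    intro a ha
    have h1 : chartMetric p y a a = 0 := DFunLike.congr_fun ha a
    rw [chartMetric, inner_self_eq_zero] at h1
    have h2 := mfderiv_comp_mfderiv_symm p hy a
    rw [h1] at h2
    rw [← h2]
    exact map_zero (mfderiv 𝓘(ℝ, E) 𝓘(ℝ, E) (extChartAt 𝓘(ℝ, E) p) _)
  have hdim : Module.finrank ℝ E = Module.finrank ℝ (E →L[ℝ] ℝ) := by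
    rw [← (LinearMap.toContinuousLinearMap (𝕜 := ℝ) (E := E) (F' := ℝ)).finrank_eq]
    exact (Subspace.dual_finrank_eq).symm
  exact ⟨(LinearEquiv.ofInjectiveOfFinrankEq (metricForm p y).toLinearMap hinj
    hdim).toContinuousLinearEquiv, by ext; rfl⟩

variable [IsContMDiffRiemannianBundle 𝓘(ℝ, E) ∞ E (fun x : M => TangentSpace 𝓘(ℝ, E) x)]

theorem contDiffOn_metricForm (p : M) :
    ContDiffOn ℝ ∞ (metricForm p) (extChartAt 𝓘(ℝ, E) p).target :=
  contDiffOn_clm_apply.2 fun a => contDiffOn_clm_apply.2 fun b => contDiffOn_chartMetric p a b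

theorem contDiffAt_metricForm (p : M) {y : E} (hy : y ∈ (extChartAt 𝓘(ℝ, E) p).target) :
    ContDiffAt ℝ ∞ (metricForm p) y :=
  (contDiffOn_metricForm p).contDiffAt ((isOpen_extChartAt_target p).mem_nhds hy)

theorem fderiv_chartMetric (p : M) {y : E} (hy : y ∈ (extChartAt 𝓘(ℝ, E) p).target) (a b c : E) :
    fderiv ℝ (fun q => chartMetric p q a b) y c = fderiv ℝ (metricForm p) y c a b := by
  have h : HasFDerivAt (metricForm p) _ y :=
    ((contDiffAt_metricForm p hy).differentiableAt (by simp)).hasFDerivAt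
  have h1 := (h.clm_apply (hasFDerivAt_const a y)).clm_apply (hasFDerivAt_const b y)
  rw [HasFDerivAt.fderiv (f := fun q => chartMetric p q a b) h1]
  simp

theorem christoffel_eq (p : M) {y : E} (hy : y ∈ (extChartAt 𝓘(ℝ, E) p).target) (a b c : E) :
    christoffel p y a b c = (fderiv ℝ (metricForm p) y a b c + fderiv ℝ (metricForm p) y b a c
      - fderiv ℝ (metricForm p) y c a b) / 2 := by
  simp only [christoffel, fderiv_chartMetric p hy]

/-- The Christoffel symbol of the first kind as a continuous linear form in its last argument. -/
def christoffelForm (p : M) (y a b : E) : E →L[ℝ] ℝ :=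
  (2⁻¹ : ℝ) • (fderiv ℝ (metricForm p) y a b + fderiv ℝ (metricForm p) y b a
    - ((fderiv ℝ (metricForm p) y).flip a).flip b)

theorem christoffelForm_apply (p : M) {y : E} (hy : y ∈ (extChartAt 𝓘(ℝ, E) p).target)
    (a b c : E) : christoffelForm p y a b c = christoffel p y a b c := by
  rw [christoffel_eq p hy, christoffelForm]
  simp
  ring

/-- The acceleration, in the chart around `p`, of a geodesic with position `y` and velocity `v`. -/
def geodesicAccel (p : M) (y v : E) : E :=
  -(metricForm p y).inverse (christoffelForm p y v v)

/-- Nondegeneracy of the metric lets the weak equation, tested against every `c`, be solved for the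
acceleration. -/
theorem eq_geodesicAccel (p : M) {y : E} (hy : y ∈ (extChartAt 𝓘(ℝ, E) p).target) {v v' : E}
    (h : ∀ c, chartMetric p y v' c + christoffel p y v v c = 0) : v' = geodesicAccel p y v := by
  have h1 : metricForm p y (-v') = christoffelForm p y v v := by
    ext c
    rw [christoffelForm_apply p hy, map_neg]
    change -chartMetric p y v' c = _
    linarith [h c]
  rw [geodesicAccel, ← h1]
  obtain ⟨e, he⟩ := isInvertible_metricForm p hy
  rw [← he]
  simp

/-- Provides the local Lipschitz bound needed for uniqueness of solutions. -/
theorem contDiffAt_geodesicAccel (p : M) {y : E} (hy : y ∈ (extChartAt 𝓘(ℝ, E) p).target) (v : E) :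
    ContDiffAt ℝ 1 (fun z : E × E => geodesicAccel p z.1 z.2) (y, v) := by
  have hfst : ContDiffAt ℝ 1 (Prod.fst : E × E → E) (y, v) := contDiffAt_fst
  have hsnd : ContDiffAt ℝ 1 (Prod.snd : E × E → E) (y, v) := contDiffAt_snd
  have hG2 : ContDiffAt ℝ 2 (metricForm p) y :=
    contDiffAt_infty.1 (contDiffAt_metricForm p hy) 2
  have hG : ContDiffAt ℝ 1 (fun z : E × E => metricForm p z.1) (y, v) :=
    ContDiffAt.comp (g := metricForm p) (y, v) (hG2.of_le one_le_two) hfst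
  have hD : ContDiffAt ℝ 1 (fun z : E × E => fderiv ℝ (metricForm p) z.1) (y, v) :=
    ContDiffAt.comp (y, v) (hG2.fderiv_right (m := 1) (by norm_num)) hfst
  have hinv : ContDiffAt ℝ 1 (fun z : E × E => (metricForm p z.1).inverse) (y, v) :=
    ContDiffAt.comp (g := ContinuousLinearMap.inverse) (y, v)
      (isInvertible_metricForm p hy).contDiffAt_map_inverse hG
  refine (hinv.clm_apply ?_).neg
  have hDv := (hD.clm_apply hsnd).clm_apply hsnd
  have hF := (((ContinuousLinearMap.flipₗᵢ ℝ E E (E →L[ℝ] ℝ)).contDiff.contDiffAt.comp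
    (y, v) hD).clm_apply hsnd)
  have hFF := (((ContinuousLinearMap.flipₗᵢ ℝ E E ℝ).contDiff.contDiffAt.comp
    (y, v) hF).clm_apply hsnd)
  exact ((hDv.add hDv).sub hFF).const_smul (2⁻¹ : ℝ)

end Metric

/-! ### Isometry of parallel transport, rescaling and uniqueness of geodesics -/

section Geodesics

open Filter Topology

variable {E : Type*} [NormedAddCommGroup E] [NormedSpace ℝ E]
  {M : Type*} [MetricSpace M] [ChartedSpace E M] [IsManifold 𝓘(ℝ, E) ∞ M]

omit [IsManifold 𝓘(ℝ, E) ∞ M] in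
theorem eventually_mem_chartAt_source {γ : ℝ → M}
    (hγ : MDifferentiableOn 𝓘(ℝ, ℝ) 𝓘(ℝ, E) γ (Icc 0 1)) (p : M) {t : ℝ}
    (ht : t ∈ Icc (0 : ℝ) 1) (hp : γ t ∈ (chartAt E p).source) :
    ∀ᶠ s in 𝓝[Icc 0 1] t, γ s ∈ (chartAt E p).source :=
  (hγ t ht).continuousWithinAt ((chartAt E p).open_source.mem_nhds hp)

omit [IsManifold 𝓘(ℝ, E) ∞ M] in
theorem velocity_comp_mul {γ : ℝ → M} (hγ : MDifferentiableOn 𝓘(ℝ, ℝ) 𝓘(ℝ, E) γ (Icc 0 1))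
    {s : ℝ} (hs : s ∈ Icc (0 : ℝ) 1) {t : ℝ} (ht : t ∈ Icc (0 : ℝ) 1) :
    MDifferentiableWithinAt 𝓘(ℝ, ℝ) 𝓘(ℝ, E) (fun r => γ (s * r)) (Icc 0 1) t ∧
    velocity (E := E) (fun r => γ (s * r)) t = s • velocity (E := E) γ (s * t) := by
  have hmaps : MapsTo (fun r : ℝ => s * r) (Icc 0 1) (Icc 0 1) := fun r hr =>
    ⟨mul_nonneg hs.1 hr.1, mul_le_one₀ hs.2 hr.1 hr.2⟩
  have h1 := (hγ (s * t) (hmaps ht)).hasMFDerivWithinAt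
  have h2 : HasMFDerivWithinAt 𝓘(ℝ, ℝ) 𝓘(ℝ, ℝ) (fun r : ℝ => s * r) (Icc 0 1) t
      (s • ContinuousLinearMap.id ℝ ℝ) :=
    (((hasFDerivAt_id t).const_smul s).hasFDerivWithinAt).hasMFDerivWithinAt
  have h3 := h1.comp t h2 hmaps
  refine ⟨h3.mdifferentiableWithinAt, ?_⟩
  have hu : UniqueMDiffWithinAt 𝓘(ℝ, ℝ) (Icc (0 : ℝ) 1) t :=
    (uniqueDiffOn_Icc zero_lt_one t ht).uniqueMDiffWithinAt
  have h4 := congrArg (fun L : ℝ →L[ℝ] E => L 1) (h3.mfderivWithin hu)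
  refine h4.trans ?_
  refine Eq.trans ?_ (map_smul (mfderivWithin 𝓘(ℝ, ℝ) 𝓘(ℝ, E) γ (Icc 0 1) (s * t)) s (1 : ℝ))
  rfl

omit [IsManifold 𝓘(ℝ, E) ∞ M] in
theorem initial_velocity_comp_mul {γ : ℝ → M}
    (hγ : MDifferentiableOn 𝓘(ℝ, ℝ) 𝓘(ℝ, E) γ (Icc 0 1)) {x : M} {v : TangentSpace 𝓘(ℝ, E) x}
    (hv : (⟨γ 0, velocity γ 0⟩ : TangentBundle 𝓘(ℝ, E) M) = ⟨x, v⟩) {s : ℝ}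
    (hs : s ∈ Icc (0 : ℝ) 1) :
    (⟨γ (s * 0), velocity (fun t => γ (s * t)) 0⟩ : TangentBundle 𝓘(ℝ, E) M) = ⟨x, s • v⟩ := by
  -- The type of the velocity depends on the base point, so `s * 0` is generalized to `r` before
  -- being replaced by `0`.
  have key : ∀ r : ℝ, r = 0 →
      (⟨γ r, s • velocity (E := E) γ r⟩ : TangentBundle 𝓘(ℝ, E) M) = ⟨x, s • v⟩ := by
    rintro r rfl
    exact congrArg (fun z : TangentBundle 𝓘(ℝ, E) M =>
      (⟨z.1, s • z.2⟩ : TangentBundle 𝓘(ℝ, E) M)) hv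
  rw [(velocity_comp_mul hγ hs ⟨le_rfl, zero_le_one⟩).2]
  exact key _ (mul_zero s)

variable [RiemannianBundle (fun x : M => TangentSpace 𝓘(ℝ, E) x)]
  [IsContMDiffRiemannianBundle 𝓘(ℝ, E) ∞ E (fun x : M => TangentSpace 𝓘(ℝ, E) x)]
  [FiniteDimensional ℝ E]

/-- Metric compatibility of the Levi-Civita connection: `⟨V, V⟩` has zero derivative along the
curve. -/
theorem IsParallelAlong.norm_eq {γ : ℝ → M} {V : ∀ t, TangentSpace 𝓘(ℝ, E) (γ t)}
    (hV : IsParallelAlong γ V) (hγ : MDifferentiableOn 𝓘(ℝ, ℝ) 𝓘(ℝ, E) γ (Icc 0 1)) {t : ℝ}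
    (ht : t ∈ Icc (0 : ℝ) 1) : ‖V t‖ = ‖V 0‖ := by
  have key : ∀ r ∈ Icc (0 : ℝ) 1,
      HasDerivWithinAt (fun s => (inner ℝ (V s) (V s) : ℝ)) 0 (Icc 0 1) r := by
    intro r hr
    set p := γ r with hp
    have hs : γ r ∈ (chartAt E p).source := mem_chart_source E p
    have hy : extChartAt 𝓘(ℝ, E) p (γ r) ∈ (extChartAt 𝓘(ℝ, E) p).target :=
      (extChartAt 𝓘(ℝ, E) p).map_source (by simpa using hs)
    obtain ⟨V', hV', hpar⟩ := hV p r hr hs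
    have hx := hasDerivWithinAt_extChartAt_comp hγ p hr hs
    have hG : HasFDerivAt (metricForm p) _ (extChartAt 𝓘(ℝ, E) p (γ r)) :=
      ((contDiffAt_metricForm p hy).differentiableAt (by simp)).hasFDerivAt
    have hGx := hG.comp_hasDerivWithinAt r hx
    have h := (hGx.clm_apply hV').clm_apply hV'
    -- With test vector `c = V`, two of the three Christoffel terms cancel, leaving `g(V', V) +
    -- (∂_γ' g)(V, V) / 2 = 0`, half the derivative of `g(V, V)`.
    have h0 := hpar (chartVec p (γ r) (V r))
    rw [christoffel_eq p hy] at h0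
    refine (h.congr_of_eventuallyEq ?_ ?_).congr_deriv ?_
    · filter_upwards [eventually_mem_chartAt_source hγ p hr hs] with s hs
      exact (chartMetric_chartVec p hs (V s) (V s)).symm
    · exact (chartMetric_chartVec p hs (V r) (V r)).symm
    · simp only [Function.comp_apply, add_apply, metricForm_apply]
      rw [chartMetric_comm p _ (chartVec p (γ r) (V r)) V']
      linarith
  have h := constant_of_derivWithin_zero (fun r hr => (key r hr).differentiableWithinAt)
    (fun r hr => (key r (Ico_subset_Icc_self hr)).derivWithin
      (uniqueDiffOn_Icc zero_lt_one r (Ico_subset_Icc_self hr))) t ht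
  rw [real_inner_self_eq_norm_sq, real_inner_self_eq_norm_sq] at h
  exact (sq_eq_sq₀ (norm_nonneg _) (norm_nonneg _)).1 h

theorem IsGeodesic.comp_mul {γ : ℝ → M} (hγ : IsGeodesic E γ) {s : ℝ} (hs : s ∈ Icc (0 : ℝ) 1) :
    IsGeodesic E (fun t => γ (s * t)) := by
  have hmaps : MapsTo (fun r : ℝ => s * r) (Icc 0 1) (Icc 0 1) := fun r hr =>
    ⟨mul_nonneg hs.1 hr.1, mul_le_one₀ hs.2 hr.1 hr.2⟩
  refine ⟨fun t ht => (velocity_comp_mul hγ.1 hs ht).1, fun p t ht hp => ?_⟩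
  have hvec : ∀ r ∈ Icc (0 : ℝ) 1, chartVec p (γ (s * r)) (velocity (E := E) (fun r => γ (s * r)) r)
      = s • chartVec p (γ (s * r)) (velocity (E := E) γ (s * r)) := fun r hr => by
    rw [(velocity_comp_mul hγ.1 hs hr).2]
    exact map_smul (mfderiv 𝓘(ℝ, E) 𝓘(ℝ, E) (extChartAt 𝓘(ℝ, E) p) (γ (s * r))) s _
  obtain ⟨V', hV', hpar⟩ := hγ.2 p (s * t) (hmaps ht) hp
  have hy : extChartAt 𝓘(ℝ, E) p (γ (s * t)) ∈ (extChartAt 𝓘(ℝ, E) p).target :=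
    (extChartAt 𝓘(ℝ, E) p).map_source (by simpa using hp)
  have hm : HasDerivWithinAt (fun r : ℝ => s * r) s (Icc 0 1) t := by
    simpa using (hasDerivWithinAt_id t (Icc 0 1)).const_mul s
  -- One factor `s` comes from the velocity, one from the chain rule; the Christoffel term is
  -- quadratic in the velocity, so it scales by `s²` too.
  refine ⟨s • s • V', ((hV'.scomp t hm hmaps).const_smul s).congr hvec (hvec t ht), fun c => ?_⟩
  have h := hpar c
  rw [christoffel_eq p hy] at h ⊢
  rw [hvec t ht]
  simp only [chartMetric_smul_left, map_smul, smul_apply, smul_eq_mul]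
  linear_combination s * s * h

/-- The components, in the chart around `p`, of a point of the tangent bundle. -/
def chartLift (p : M) (z : TangentBundle 𝓘(ℝ, E) M) : E × E :=
  (extChartAt 𝓘(ℝ, E) p z.1, chartVec p z.1 z.2)

/-- The position and velocity of a curve, as a point of the tangent bundle. -/
def velocityLift (γ : ℝ → M) (t : ℝ) : TangentBundle 𝓘(ℝ, E) M := ⟨γ t, velocity γ t⟩

theorem IsGeodesic.hasDerivWithinAt_chartLift {γ : ℝ → M} (hγ : IsGeodesic E γ) (p : M) {t : ℝ}
    (ht : t ∈ Icc (0 : ℝ) 1) (hp : γ t ∈ (chartAt E p).source) :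
    HasDerivWithinAt (fun s => chartLift p (velocityLift (E := E) γ s))
      ((chartLift p (velocityLift γ t)).2, geodesicAccel p (chartLift p (velocityLift γ t)).1
        (chartLift p (velocityLift γ t)).2) (Icc 0 1) t := by
  obtain ⟨V', hV', hpar⟩ := hγ.2 p t ht hp
  have hy : extChartAt 𝓘(ℝ, E) p (γ t) ∈ (extChartAt 𝓘(ℝ, E) p).target :=
    (extChartAt 𝓘(ℝ, E) p).map_source (by simpa using hp)
  have h := (hasDerivWithinAt_extChartAt_comp hγ.1 p ht hp).prodMk hV'
  rw [eq_geodesicAccel p hy hpar] at h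
  exact h

/-- In a chart, position and velocity solve a first-order equation with locally Lipschitz right-hand
side, so agreement at `t` persists to the right. -/
theorem IsGeodesic.eventually_velocityLift_eq {γ₁ γ₂ : ℝ → M} (h₁ : IsGeodesic E γ₁)
    (h₂ : IsGeodesic E γ₂) {t : ℝ} (ht : t ∈ Ico (0 : ℝ) 1)
    (h : velocityLift (E := E) γ₁ t = velocityLift γ₂ t) :
    ∀ᶠ s in 𝓝[>] t, velocityLift (E := E) γ₁ s = velocityLift γ₂ s := by
  set p := γ₁ t with hp
  have ht' : t ∈ Icc (0 : ℝ) 1 := Ico_subset_Icc_self ht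
  have hs₁ : γ₁ t ∈ (chartAt E p).source := mem_chart_source E p
  have hs₂ : γ₂ t ∈ (chartAt E p).source := by
    have : γ₁ t = γ₂ t := congrArg (fun z : TangentBundle 𝓘(ℝ, E) M => z.1) h
    rwa [← this]
  have hy : extChartAt 𝓘(ℝ, E) p (γ₁ t) ∈ (extChartAt 𝓘(ℝ, E) p).target :=
    (extChartAt 𝓘(ℝ, E) p).map_source (by simpa using hs₁)
  have hF : ContDiffAt ℝ 1 (fun z : E × E => (z.2, geodesicAccel p z.1 z.2))
      (chartLift p (velocityLift γ₁ t)) :=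
    contDiffAt_snd.prodMk (contDiffAt_geodesicAccel p hy _)
  obtain ⟨K, U, hU, hK⟩ := hF.exists_lipschitzOnWith
  have hev {γ : ℝ → M} (hγ : IsGeodesic E γ) (hs : γ t ∈ (chartAt E p).source)
      (hU : U ∈ 𝓝 (chartLift p (velocityLift (E := E) γ t))) :
      ∀ᶠ s in 𝓝[≥] t, s ∈ Icc t 1 ∧ γ s ∈ (chartAt E p).source ∧
        chartLift p (velocityLift (E := E) γ s) ∈ U := by
    rw [← nhdsWithin_Icc_eq_nhdsGE ht.2]
    have hle : 𝓝[Icc t 1] t ≤ 𝓝[Icc 0 1] t := nhdsWithin_mono _ (Icc_subset_Icc_left ht.1)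
    filter_upwards [self_mem_nhdsWithin, hle (eventually_mem_chartAt_source hγ.1 p ht' hs),
      hle ((hγ.hasDerivWithinAt_chartLift p ht' hs).continuousWithinAt hU)] with s a b c
    exact ⟨a, b, c⟩
  -- On `[t, u]` both curves stay in the chart and both lifts stay in the Lipschitz neighbourhood
  -- `U`.
  obtain ⟨u, hu, hsub⟩ := mem_nhdsGE_iff_exists_Icc_subset.1
    ((hev h₁ hs₁ hU).and (hev h₂ hs₂ (by rwa [← h])))
  have hcont {γ : ℝ → M} (hγ : IsGeodesic E γ)
      (hsrc : ∀ s ∈ Icc t u, s ∈ Icc t 1 ∧ γ s ∈ (chartAt E p).source) :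
      ContinuousOn (fun s => chartLift p (velocityLift (E := E) γ s)) (Icc t u) := fun s hs =>
    (hγ.hasDerivWithinAt_chartLift p (Icc_subset_Icc_left ht.1 (hsrc s hs).1)
      (hsrc s hs).2).continuousWithinAt.mono fun r hr => Icc_subset_Icc_left ht.1 (hsrc r hr).1
  have hderiv {γ : ℝ → M} (hγ : IsGeodesic E γ)
      (hsrc : ∀ s ∈ Icc t u, s ∈ Icc t 1 ∧ γ s ∈ (chartAt E p).source) (s : ℝ) (hs : s ∈ Ico t u) :
      HasDerivWithinAt (fun s => chartLift p (velocityLift (E := E) γ s))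
      ((chartLift p (velocityLift γ s)).2, geodesicAccel p (chartLift p (velocityLift γ s)).1
        (chartLift p (velocityLift γ s)).2) (Ici s) s := by
    have hs' := hsrc s (Ico_subset_Icc_self hs)
    have hs1 : s < 1 := hs.2.trans_le (hsrc u ⟨(le_of_lt hu), le_rfl⟩).1.2
    refine ((hγ.hasDerivWithinAt_chartLift p (Icc_subset_Icc_left ht.1 hs'.1)
      hs'.2).mono (Icc_subset_Icc_left (ht.1.trans hs.1))).mono_of_mem_nhdsWithin ?_
    exact Icc_mem_nhdsGE hs1
  have heq := ODE_solution_unique_of_mem_Icc_right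
    (v := fun _ z => (z.2, geodesicAccel p z.1 z.2)) (s := fun _ => U) (fun _ _ => hK)
    (hcont h₁ fun s hs => ⟨(hsub hs).1.1, (hsub hs).1.2.1⟩)
    (hderiv h₁ fun s hs => ⟨(hsub hs).1.1, (hsub hs).1.2.1⟩)
    (fun s hs => (hsub (Ico_subset_Icc_self hs)).1.2.2)
    (hcont h₂ fun s hs => ⟨(hsub hs).2.1, (hsub hs).2.2.1⟩)
    (hderiv h₂ fun s hs => ⟨(hsub hs).2.1, (hsub hs).2.2.1⟩)
    (fun s hs => (hsub (Ico_subset_Icc_self hs)).2.2.2)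
    (congrArg (chartLift p) h)
  filter_upwards [Icc_mem_nhdsGT hu] with s hs
  have := heq hs
  exact totalSpace_eq_of_chart_eq p (hsub hs).1.2.1 (hsub hs).2.2.1
    (congrArg Prod.fst this) (congrArg Prod.snd this)

/-- A geodesic is determined by its initial velocity. -/
theorem IsGeodesic.eqOn {γ₁ γ₂ : ℝ → M} (h₁ : IsGeodesic E γ₁) (h₂ : IsGeodesic E γ₂)
    (h : (⟨γ₁ 0, velocity γ₁ 0⟩ : TangentBundle 𝓘(ℝ, E) M) = ⟨γ₂ 0, velocity γ₂ 0⟩) :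
    EqOn γ₁ γ₂ (Icc 0 1) := by
  set S : Set ℝ := {t | velocityLift (E := E) γ₁ t = velocityLift γ₂ t} with hS
  have hfst : ∀ s ∈ S, γ₁ s = γ₂ s := fun s hs =>
    congrArg (fun z : TangentBundle 𝓘(ℝ, E) M => z.1) hs
  suffices hsub : Icc 0 1 ⊆ S from fun t ht => hfst t (hsub ht)
  -- Continuous induction on `[0, 1]`: the agreement set contains `0`, is closed, and extends to the
  -- right of each of its points below `1`.
  refine IsClosed.Icc_subset_of_forall_mem_nhdsWithin ?_ h
    fun t ht => h₁.eventually_velocityLift_eq h₂ ht.2 ht.1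
  refine isClosed_of_closure_subset fun t ht => ?_
  have htI : t ∈ Icc (0 : ℝ) 1 :=
    closure_minimal inter_subset_right isClosed_Icc ht
  refine ⟨?_, htI⟩
  have hne : (𝓝[S ∩ Icc 0 1] t).NeBot := mem_closure_iff_nhdsWithin_neBot.1 ht
  -- Base points are compared first, so that a single chart then serves to take the limit of both
  -- velocities.
  have hpt : γ₁ t = γ₂ t :=
    tendsto_nhds_unique_of_eventuallyEq (l := 𝓝[S ∩ Icc 0 1] t)
      (((h₁.1 t htI).continuousWithinAt).mono inter_subset_right)
      (((h₂.1 t htI).continuousWithinAt).mono inter_subset_right)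
      (by filter_upwards [self_mem_nhdsWithin] with s hs using hfst s hs.1)
  set p := γ₁ t with hp
  have hs₁ : γ₁ t ∈ (chartAt E p).source := mem_chart_source E p
  have hs₂ : γ₂ t ∈ (chartAt E p).source := by rw [← hpt]; exact hs₁
  have hlift : chartLift p (velocityLift γ₁ t) = chartLift p (velocityLift γ₂ t) :=
    tendsto_nhds_unique_of_eventuallyEq (l := 𝓝[S ∩ Icc 0 1] t)
      ((h₁.hasDerivWithinAt_chartLift p htI hs₁).continuousWithinAt.mono inter_subset_right)
      ((h₂.hasDerivWithinAt_chartLift p htI hs₂).continuousWithinAt.mono inter_subset_right)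
      (by filter_upwards [self_mem_nhdsWithin] with s hs using congrArg (chartLift p) hs.1)
  exact totalSpace_eq_of_chart_eq p hs₁ hs₂ (congrArg Prod.fst hlift) (congrArg Prod.snd hlift)

theorem HasExp.unique {x : M} {v : TangentSpace 𝓘(ℝ, E) x} {y z : M} (hy : HasExp x v y)
    (hz : HasExp x v z) : y = z := by
  obtain ⟨γ₁, h₁, hv₁, rfl⟩ := hy
  obtain ⟨γ₂, h₂, hv₂, rfl⟩ := hz
  exact h₁.eqOn h₂ (hv₁.trans hv₂.symm) ⟨zero_le_one, le_rfl⟩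

end Geodesics

/-! ### Logarithms, strong convexity and the scaling inequality -/

section Scaling

variable {E : Type*} [NormedAddCommGroup E] [NormedSpace ℝ E] [FiniteDimensional ℝ E]
  {M : Type*} [MetricSpace M] [ChartedSpace E M] [IsManifold 𝓘(ℝ, E) ∞ M]
  [RiemannianBundle (fun x : M => TangentSpace 𝓘(ℝ, E) x)]
  [IsContMDiffRiemannianBundle 𝓘(ℝ, E) ∞ E (fun x : M => TangentSpace 𝓘(ℝ, E) x)]

theorem IsGeodesic.hasExp_smul {γ : ℝ → M} (hγ : IsGeodesic E γ) {x : M}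
    {v : TangentSpace 𝓘(ℝ, E) x}
    (hv : (⟨γ 0, velocity γ 0⟩ : TangentBundle 𝓘(ℝ, E) M) = ⟨x, v⟩) {s : ℝ}
    (hs : s ∈ Icc (0 : ℝ) 1) : HasExp x (s • v) (γ s) :=
  ⟨_, hγ.comp_mul hs, initial_velocity_comp_mul hγ.1 hv hs, by rw [mul_one]⟩

omit [FiniteDimensional ℝ E] [IsManifold 𝓘(ℝ, E) ∞ M]
  [IsContMDiffRiemannianBundle 𝓘(ℝ, E) ∞ E (fun x : M => TangentSpace 𝓘(ℝ, E) x)] in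
theorem IsUniquelyGeodesicallyConvex.isLog_logMap {C : Set M}
    (hC : IsUniquelyGeodesicallyConvex E C) {x y : M} (hx : x ∈ C) (hy : y ∈ C) :
    IsLog C x y (logMap C x y : TangentSpace 𝓘(ℝ, E) x) := by
  have h : ∃ v : TangentSpace 𝓘(ℝ, E) x, IsLog C x y v := by
    obtain ⟨γ, hγ, hmin⟩ := hC.exists_minimizing x hx y hy
    obtain ⟨hg, rfl, h1, hm⟩ := hγ
    exact ⟨velocity γ 0, γ, ⟨hg, rfl, h1, hm⟩, hmin, rfl⟩
  rw [logMap, dif_pos h]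
  exact h.choose_spec

omit [FiniteDimensional ℝ E] [IsManifold 𝓘(ℝ, E) ∞ M]
  [RiemannianBundle (fun x : M => TangentSpace 𝓘(ℝ, E) x)]
  [IsContMDiffRiemannianBundle 𝓘(ℝ, E) ∞ E (fun x : M => TangentSpace 𝓘(ℝ, E) x)] in
theorem velocity_congr {γ₁ γ₂ : ℝ → M} (h : EqOn γ₁ γ₂ (Icc 0 1)) {t : ℝ}
    (ht : t ∈ Icc (0 : ℝ) 1) :
    (⟨γ₁ t, velocity γ₁ t⟩ : TangentBundle 𝓘(ℝ, E) M) = ⟨γ₂ t, velocity γ₂ t⟩ := by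
  refine TotalSpace.ext (h ht) (heq_of_eq ?_)
  exact congrArg (fun L : ℝ →L[ℝ] E => L 1) (mfderivWithin_congr h (h ht))

omit [FiniteDimensional ℝ E] [IsManifold 𝓘(ℝ, E) ∞ M]
  [IsContMDiffRiemannianBundle 𝓘(ℝ, E) ∞ E (fun x : M => TangentSpace 𝓘(ℝ, E) x)] in
/-- The initial velocity of a geodesic contained in `C` is the logarithm of its end point. -/
theorem IsUniquelyGeodesicallyConvex.logMap_eq {C : Set M}
    (hC : IsUniquelyGeodesicallyConvex E C) {x y : M} {γ : ℝ → M} (hγ : IsGeodesicIn E C x y γ)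
    {v : TangentSpace 𝓘(ℝ, E) x}
    (hv : (⟨γ 0, velocity γ 0⟩ : TangentBundle 𝓘(ℝ, E) M) = ⟨x, v⟩) : logMap C x y = v := by
  have hx : x ∈ C := hγ.2.1 ▸ hγ.2.2.2 ⟨le_rfl, zero_le_one⟩
  have hy : y ∈ C := hγ.2.2.1 ▸ hγ.2.2.2 ⟨zero_le_one, le_rfl⟩
  obtain ⟨τ, hτ, -, hτv⟩ := hC.isLog_logMap hx hy
  have h := velocity_congr (E := E) (hC.unique x hx y hy γ τ hγ hτ)
    (⟨le_rfl, zero_le_one⟩ : (0 : ℝ) ∈ Icc (0 : ℝ) 1)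
  have h' := (hτv.symm.trans h.symm).trans hv
  exact eq_of_heq (TotalSpace.mk.inj h').2

omit [FiniteDimensional ℝ E] [IsManifold 𝓘(ℝ, E) ∞ M]
  [IsContMDiffRiemannianBundle 𝓘(ℝ, E) ∞ E (fun x : M => TangentSpace 𝓘(ℝ, E) x)] in
/-- If vector addition is an exponential map operator at `x` and some exponential exists at `x`,
then all exponentials exist at `x`. -/
theorem IsExpMapOperator.exists_geodesic {x : M}
    (hadd : IsExpMapOperator x (fun u v : TangentSpace 𝓘(ℝ, E) x => u + v))
    {u : TangentSpace 𝓘(ℝ, E) x} {y : M} (hu : HasExp x u y) (v : TangentSpace 𝓘(ℝ, E) x) :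
    ∃ γ : ℝ → M, IsGeodesic E γ ∧
      (⟨γ 0, velocity γ 0⟩ : TangentBundle 𝓘(ℝ, E) M) = ⟨x, v⟩ := by
  -- Since `u = v + (u - v)`, the double exponential of `v` and `u - v` exists, and its first leg is
  -- the wanted geodesic.
  obtain ⟨γ, -, hγ, hv, -⟩ := (hadd v (u - v) y).1 (by simpa using hu)
  exact ⟨γ, hγ, hv⟩

/-- Double exponentials of small second argument along a geodesic of `C` stay in `C`. -/
theorem IsDoubleGeodesicallyStronglyConvex.hasDoubleExp_mem {α : ℝ} {d : M → M → ℝ} {C : Set M}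
    (hC : IsDoubleGeodesicallyStronglyConvex E α d C) {x y : M} {γ : ℝ → M}
    (hγ : IsGeodesicIn E C x y γ) {u : TangentSpace 𝓘(ℝ, E) x}
    (hu : (⟨γ 0, velocity γ 0⟩ : TangentBundle 𝓘(ℝ, E) M) = ⟨x, u⟩) {t : ℝ}
    (ht : t ∈ Icc (0 : ℝ) 1) {v : TangentSpace 𝓘(ℝ, E) x}
    (hv : ‖v‖ ≤ α * t * (1 - t) * d x y ^ 2) {q : M} (hq : HasDoubleExp x (t • u) v q) :
    q ∈ C := by
  have hx : x ∈ C := hγ.2.1 ▸ hγ.2.2.2 ⟨le_rfl, zero_le_one⟩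
  have hy : y ∈ C := hγ.2.2.1 ▸ hγ.2.2.2 ⟨zero_le_one, le_rfl⟩
  obtain ⟨τ, V, hτ, hτu, hV, hV0, hexp⟩ := hq
  -- Both points are `Exp_x(t u)`, so strong convexity at `γ t` applies to the vector `V 1` based at
  -- `τ 1`.
  have hpt : γ t = τ 1 := (hγ.1.hasExp_smul hu ht).unique ⟨τ, hτ, hτu, rfl⟩
  have hnorm : ‖V 1‖ = ‖v‖ := by
    rw [hV.norm_eq hτ.1 ⟨zero_le_one, le_rfl⟩]
    exact congrArg (fun z : TangentBundle 𝓘(ℝ, E) M => ‖z.2‖) hV0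
  have key := hC x hx y hy γ hγ t ht
  rw [hpt] at key
  obtain ⟨q', hq', hexp'⟩ := key (V 1) (hnorm ▸ hv)
  rwa [hexp.unique hexp']

/-- For `‖z‖ ≤ (α / 4) d(x, y)²`, the vector `Exp_x⁻¹(y) / 2 + z` is the logarithm of a point
of `C`. -/
theorem exists_logMap_eq_half_add {α : ℝ} (hα : 0 < α) {d : M → M → ℝ} {C : Set M}
    (hC : IsUniquelyGeodesicallyConvex E C) (hCα : IsDoubleGeodesicallyStronglyConvex E α d C)
    {x y : M} (hx : x ∈ C) (hy : y ∈ C)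
    (hadd : IsExpMapOperator x (fun u v : TangentSpace 𝓘(ℝ, E) x => u + v))
    {z : TangentSpace 𝓘(ℝ, E) x} (hz : ‖z‖ ≤ α / 4 * d x y ^ 2) :
    ∃ q ∈ C, logMap C x q = (2⁻¹ : ℝ) • logMap C x y + z := by
  obtain ⟨γ, hγ, -, hγu⟩ := hC.isLog_logMap (E := E) hx hy
  set u : TangentSpace 𝓘(ℝ, E) x := logMap C x y with hu
  obtain ⟨σ, hσ, hσv⟩ := hadd.exists_geodesic ⟨γ, hγ.1, hγu, rfl⟩ ((2⁻¹ : ℝ) • u + z)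
  have hmem : MapsTo σ (Icc 0 1) C := by
    intro s hs
    have hs2 : s * 2⁻¹ ∈ Icc (0 : ℝ) 1 := ⟨by linarith [hs.1], by linarith [hs.2]⟩
    have h1 := hσ.hasExp_smul hσv hs
    rw [smul_add, smul_smul] at h1
    refine hCα.hasDoubleExp_mem hγ hγu hs2 ?_ ((hadd _ _ _).1 h1)
    rw [norm_smul, Real.norm_of_nonneg hs.1]
    -- A quarter of this quantity is the slack between `s (α / 4) d²` and the allowed radius `α (s /
    -- 2)(1 - s / 2) d²`.
    have h2 : 0 ≤ α * d x y ^ 2 * s * (1 - s) :=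
      mul_nonneg (mul_nonneg (mul_nonneg hα.le (sq_nonneg _)) hs.1) (sub_nonneg.2 hs.2)
    linarith [mul_le_mul_of_nonneg_left hz hs.1]
  have hσ0 : σ 0 = x := congrArg (fun z : TangentBundle 𝓘(ℝ, E) M => z.1) hσv
  exact ⟨σ 1, hmem ⟨zero_le_one, le_rfl⟩, hC.logMap_eq ⟨hσ, hσ0, rfl, hmem⟩ hσv⟩

theorem scalingInequality_of_isExpMapOperator_add {α : ℝ} (hα : 0 < α) {d : M → M → ℝ} {C : Set M}
    (hC : IsUniquelyGeodesicallyConvex E C) (hCα : IsDoubleGeodesicallyStronglyConvex E α d C)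
    (hadd : ∀ x ∈ C, IsExpMapOperator x (fun u v : TangentSpace 𝓘(ℝ, E) x => u + v)) :
    ScalingInequality E C (α / 2) d := by
  intro x hx w v hv hmax
  rcases eq_or_ne w 0 with rfl | hw
  · simp
  have hw' : 0 < ‖w‖ := norm_pos_iff.2 hw
  -- This multiple of `w` maximizes `⟨w, ·⟩` over the admissible ball.
  have hz : ‖(α / 4 * d x v ^ 2 / ‖w‖) • w‖ ≤ α / 4 * d x v ^ 2 := by
    rw [norm_smul, Real.norm_of_nonneg (by positivity), div_mul_cancel₀ _ hw'.ne']
  obtain ⟨q, hq, hlog⟩ := exists_logMap_eq_half_add hα hC hCα hx hv (hadd x hx) hz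
  have h : inner ℝ w (logMap C x q) ≤ inner ℝ w (logMap C x v) := hmax hq
  rw [hlog, inner_add_right, real_inner_smul_right, real_inner_smul_right,
    real_inner_self_eq_norm_sq] at h
  have h2 : α / 4 * d x v ^ 2 / ‖w‖ * ‖w‖ ^ 2 = α / 4 * d x v ^ 2 * ‖w‖ := by
    field_simp
  rw [h2] at h
  linarith

end Scaling

end RiemGeo

end

theorem mainTheorem9
    {E : Type*} [NormedAddCommGroup E] [NormedSpace ℝ E] [FiniteDimensional ℝ E]
    {M : Type*} [MetricSpace M] [ChartedSpace E M] [IsManifold 𝓘(ℝ, E) ∞ M]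
    [RiemannianBundle (fun x : M => TangentSpace 𝓘(ℝ, E) x)]
    [IsContMDiffRiemannianBundle 𝓘(ℝ, E) ∞ E (fun x : M => TangentSpace 𝓘(ℝ, E) x)]
    [IsRiemannianManifold 𝓘(ℝ, E) M] [ConnectedSpace M] [CompleteSpace M]
    (d : M → M → ℝ) (hd : RiemGeo.IsDistanceFunction d)
    (C : Set M) (hCcompact : IsCompact C) (hC : RiemGeo.IsUniquelyGeodesicallyConvex E C)
    (α : ℝ) (hα : 0 < α) (hCα : RiemGeo.IsDoubleGeodesicallyStronglyConvex E α d C)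
    (hadd : ∀ x ∈ C, RiemGeo.IsExpMapOperator x
      (fun u v : TangentSpace 𝓘(ℝ, E) x => u + v)) :
    RiemGeo.ScalingInequality E C (α / 2) d ∧
    ∀ l : ℝ, 0 < l →
      (∀ x ∈ C, ∀ y ∈ C, l * ‖(RiemGeo.logMap C x y : TangentSpace 𝓘(ℝ, E) x)‖ ≤ d x y) →
      RiemGeo.RiemannianScalingInequality E C (l ^ 2 * (α / 2)) := by
  have h := RiemGeo.scalingInequality_of_isExpMapOperator_add hα hC hCα hadd
  refine ⟨h, fun l hl hld x hx w v hv hmax => ?_⟩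
  refine ge_trans (h x hx w v hv hmax) ?_
  -- Squaring the comparison of `d` with the logarithm's norm produces the factor `l ^ 2`.
  have h1 := pow_le_pow_left₀ (mul_nonneg hl.le (norm_nonneg _)) (hld x hx v hv) 2
  have h2 := mul_le_mul_of_nonneg_left h1 (mul_nonneg (half_pos hα).le (norm_nonneg w))
  refine ge_iff_le.2 (le_trans (le_of_eq ?_) h2)
  ring
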